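/- Let $N\ge 2$, let $B(x,r)$ denote the open Euclidean ball in $\mathbb{R}^N$ with centre $x$ and radius $r>0$, and let $u\in W^{1,2}_{\mathrm{loc}}(B(0,1);\mathbb{R}^N)$ have symmetrized gradient $e(u)=\tfrac12(\nabla u+\nabla u^T)$. Assume that there is a constant $C\ge 1$ such that for every ball $B(x_0,r)\subset B(0,1)$, $$\int_{B(x_0,r)}|e(u)|^2\,dx\le C\,r^{N-1},$$ where $|\cdot|$ is the Frobenius norm. Then for every $x_0\in B(0,1)$ there exists $b_{x_0}\in\mathbb{R}^N$ such that $$\lim_{r\to0^+}\frac{1}{|B(x_0,r)|}\int_{B(x_0,r)}|u-b_{x_0}|^2\,dx=0.$$ In particular $S_u=J_u=\emptyset$. Here $S_u$ is the approximate discontinuity set of $u$, the set of all $x\in B(0,1)$ for which there is no $z\in\mathbb{R}^N$ with $\frac{1}{|B(x,r)|}\int_{B(x,r)}|u-z|\,dy\to0$ as $r\to0^+$; and $J_u$ is the jump set of $u$, the set of all $x\in B(0,1)$ for which there are $a\ne b$ in $\mathbb{R}^N$ and a unit vector $\nu$ such that the averages of $|u-a|$ over $\{y\in B(x,r):(y-x)\cdot\nu>0\}$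 and of $|u-b|$ over $\{y\in B(x,r):(y-x)\cdot\nu<0\}$ both tend to $0$ as $r\to0^+$. -/

import Mathlib

open MeasureTheory Set Filter Topology
open scoped ContDiff ENNReal

namespace SymGrad

/-- `f ∈ L²_loc(Ω)`: `f` is square-integrable on every compact subset of `Ω`. -/
def MemL2Loc {N : ℕ} {F : Type*} [NormedAddCommGroup F]
    (Ω : Set (EuclideanSpace ℝ (Fin N))) (f : EuclideanSpace ℝ (Fin N) → F) : Prop :=
  ∀ K : Set (EuclideanSpace ℝ (Fin N)), IsCompact K → K ⊆ Ω → MemLp f 2 (volume.restrict K)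

/-- `G` is a weak (distributional) gradient of the vector field `u` on `Ω`, that is, `u` and `G` are
locally integrable on `Ω` and `∫_Ω uᵢ ∂ⱼφ = - ∫_Ω Gᵢⱼ φ` for all `i`, `j` and all
`φ ∈ C_c^∞(Ω)`; thus `Gᵢⱼ = ∂ⱼuᵢ`. -/
structure IsWeakGrad {N : ℕ} (Ω : Set (EuclideanSpace ℝ (Fin N)))
    (u : EuclideanSpace ℝ (Fin N) → EuclideanSpace ℝ (Fin N))
    (G : EuclideanSpace ℝ (Fin N) → Matrix (Fin N) (Fin N) ℝ) : Prop where
  locallyIntegrableOn : LocallyIntegrableOn u Ω volume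
  locallyIntegrableOn_grad : ∀ i j, LocallyIntegrableOn (fun x => G x i j) Ω volume
  integral_eq : ∀ i j, ∀ φ : EuclideanSpace ℝ (Fin N) → ℝ,
    ContDiff ℝ ∞ φ → HasCompactSupport φ → tsupport φ ⊆ Ω →
      ∫ x in Ω, u x i * fderiv ℝ φ x (EuclideanSpace.single j 1) = - ∫ x in Ω, G x i j * φ x

/-- On an open set, weak gradients are unique up to null sets. -/
theorem IsWeakGrad.ae_eq {N : ℕ} {Ω : Set (EuclideanSpace ℝ (Fin N))}
    {u : EuclideanSpace ℝ (Fin N) → EuclideanSpace ℝ (Fin N)}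
    {G H : EuclideanSpace ℝ (Fin N) → Matrix (Fin N) (Fin N) ℝ}
    (hΩ : IsOpen Ω) (hG : IsWeakGrad Ω u G) (hH : IsWeakGrad Ω u H) :
    ∀ᵐ x ∂(volume : Measure (EuclideanSpace ℝ (Fin N))), x ∈ Ω → G x = H x := by
  have key : ∀ i j, ∀ᵐ x ∂(volume : Measure (EuclideanSpace ℝ (Fin N))),
      x ∈ Ω → G x i j - H x i j = 0 := by
    intro i j
    have hli : LocallyIntegrableOn (fun x => G x i j - H x i j) Ω volume :=
      (hG.locallyIntegrableOn_grad i j).sub (hH.locallyIntegrableOn_grad i j)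
    refine hΩ.ae_eq_zero_of_integral_contDiff_smul_eq_zero hli ?_
    intro φ hφ hc hs
    have aux : ∀ A : EuclideanSpace ℝ (Fin N) → Matrix (Fin N) (Fin N) ℝ, IsWeakGrad Ω u A →
        IntegrableOn (fun x => A x i j * φ x) Ω volume ∧
          ∫ x, A x i j * φ x = ∫ x in Ω, A x i j * φ x := by
      intro A hA
      have h0 : ∀ x, x ∉ tsupport φ → A x i j * φ x = 0 := fun x hx => by
        rw [image_eq_zero_of_notMem_tsupport hx, mul_zero]
      constructor
      · have h1 : IntegrableOn (fun x => A x i j) (tsupport φ) volume :=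
          (hA.locallyIntegrableOn_grad i j).integrableOn_compact_subset hs hc
        have h2 : IntegrableOn (fun x => A x i j * φ x) (tsupport φ) volume :=
          h1.mul_continuousOn hφ.continuous.continuousOn hc
        exact ((integrableOn_iff_integrable_of_support_subset
          (fun x hx => by_contra fun h => hx (h0 x h))).1 h2).integrableOn
      · exact (setIntegral_eq_integral_of_forall_compl_eq_zero
          (fun x hx => h0 x fun h => hx (hs h))).symm
    obtain ⟨iG, eG⟩ := aux G hG
    obtain ⟨iH, eH⟩ := aux H hH
    have e1 := hG.integral_eq i j φ hφ hc hs
    have e2 := hH.integral_eq i j φ hφ hc hs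
    have e3 : ∫ x, φ x • (G x i j - H x i j)
        = ∫ x in Ω, (G x i j * φ x - H x i j * φ x) := by
      rw [setIntegral_eq_integral_of_forall_compl_eq_zero]
      · congr 1; ext x; simp only [smul_eq_mul]; ring
      · intro x hx
        rw [image_eq_zero_of_notMem_tsupport fun h => hx (hs h)]; simp
    rw [e3, integral_sub iG iH]
    linarith
  filter_upwards [ae_all_iff.2 fun i => ae_all_iff.2 fun j => key i j] with x hx hxΩ
  ext i j
  exact sub_eq_zero.1 (hx i j hxΩ)

/-- `u ∈ W^{1,2}_loc(Ω; ℝ^N)`: `u` is in `L²_loc(Ω)` and has a weak gradient on `Ω`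
whose entries are in `L²_loc(Ω)`. -/
def MemW12Loc {N : ℕ} (Ω : Set (EuclideanSpace ℝ (Fin N)))
    (u : EuclideanSpace ℝ (Fin N) → EuclideanSpace ℝ (Fin N)) : Prop :=
  MemL2Loc Ω u ∧ ∃ G : EuclideanSpace ℝ (Fin N) → Matrix (Fin N) (Fin N) ℝ,
    IsWeakGrad Ω u G ∧ ∀ i j, MemL2Loc Ω (fun x => G x i j)

open Classical in
/-- The weak gradient `∇u` on `Ω`, a representative of the almost-everywhere class
(and `0` if there is no weak gradient). -/
noncomputable def weakGrad {N : ℕ} (Ω : Set (EuclideanSpace ℝ (Fin N)))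
    (u : EuclideanSpace ℝ (Fin N) → EuclideanSpace ℝ (Fin N)) :
    EuclideanSpace ℝ (Fin N) → Matrix (Fin N) (Fin N) ℝ :=
  if h : ∃ G : EuclideanSpace ℝ (Fin N) → Matrix (Fin N) (Fin N) ℝ, IsWeakGrad Ω u G
  then h.choose else 0

/-- The symmetrized gradient `e(u) = (∇u + ∇uᵀ) / 2` on `Ω`. -/
noncomputable def symGrad {N : ℕ} (Ω : Set (EuclideanSpace ℝ (Fin N)))
    (u : EuclideanSpace ℝ (Fin N) → EuclideanSpace ℝ (Fin N))
    (x : EuclideanSpace ℝ (Fin N)) : Matrix (Fin N) (Fin N) ℝ :=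
  (1 / 2 : ℝ) • (weakGrad Ω u x + (weakGrad Ω u x).transpose)

/-- The squared Frobenius norm `|ξ|² = ξ : ξ`. -/
def frobSq {N : ℕ} (ξ : Matrix (Fin N) (Fin N) ℝ) : ℝ := ∑ i, ∑ j, ξ i j ^ 2

/-- The approximate discontinuity set `S_u` of `u` in the sense of `BV` theory: the points `x ∈ Ω`
at which no `z` satisfies `⨍_{B(x,r)} |u - z| → 0` as `r → 0⁺`. -/
def approxDiscontSet {N : ℕ} (Ω : Set (EuclideanSpace ℝ (Fin N)))
    (u : EuclideanSpace ℝ (Fin N) → EuclideanSpace ℝ (Fin N)) :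
    Set (EuclideanSpace ℝ (Fin N)) :=
  {x | x ∈ Ω ∧ ¬ ∃ z : EuclideanSpace ℝ (Fin N),
    Tendsto (fun r : ℝ => ⨍⁻ y in Metric.ball x r, ‖u y - z‖ₑ ∂volume) (𝓝[>] 0) (𝓝 0)}

/-- The open half ball `{y ∈ B(x,r) : (y - x) · ν > 0}`. -/
def halfBall {N : ℕ} (x : EuclideanSpace ℝ (Fin N)) (r : ℝ) (ν : EuclideanSpace ℝ (Fin N)) :
    Set (EuclideanSpace ℝ (Fin N)) :=
  {y | y ∈ Metric.ball x r ∧ 0 < inner ℝ (y - x) ν}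

/-- The jump set `J_u` of `u` in the sense of `BV` theory: the points `x ∈ Ω` with distinct
one-sided approximate limits `a`, `b` on the two sides of a hyperplane through `x`. -/
def jumpSet {N : ℕ} (Ω : Set (EuclideanSpace ℝ (Fin N)))
    (u : EuclideanSpace ℝ (Fin N) → EuclideanSpace ℝ (Fin N)) :
    Set (EuclideanSpace ℝ (Fin N)) :=
  {x | x ∈ Ω ∧ ∃ a b ν : EuclideanSpace ℝ (Fin N), a ≠ b ∧ ‖ν‖ = 1 ∧
    Tendsto (fun r : ℝ => ⨍⁻ y in halfBall x r ν, ‖u y - a‖ₑ ∂volume) (𝓝[>] 0) (𝓝 0) ∧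
    Tendsto (fun r : ℝ => ⨍⁻ y in halfBall x r (-ν), ‖u y - b‖ₑ ∂volume) (𝓝[>] 0) (𝓝 0)}

end SymGrad

namespace SymGrad

open scoped Convolution

/-! The growth hypothesis forces `u` to be locally `1/2`-Hölder up to a null set, and this is proved
without Korn's inequality. By Young's inequality the integral of `|e(u)|` over a ball of radius `r`
is `O(r^(N-1/2))`. For a smooth field `v` with this bound, the component of `v z - v x` along `z -
x` is the integral of `e(v)` on the segment from `x` to `z`, tested twice against `z - x`. Averaging
over `z ∈ B(x,r)` makes `|⟨v z - v x, z - x⟩|` of order `r^(3/2)` (`lintegral_abs_inner_sub_le`).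

To recover all components, take three centres `x`, `x + h`, `x + 2h` and a common endpoint `z`. With
weights `1, -2, 1` the terms in `v z` cancel, and what is left is affine in `z` with slope minus the
second difference of `v`. Hence that difference is `O(√‖h‖)` (`exists_second_difference_bound`). As
`1/2 < 1`, a bound on second differences together with a sup bound yields a Hölder bound by dyadic
doubling (`exists_holder_bound`).

The constants depend only on the growth constant, an `L¹` norm, the dimension and a radius, so they
are uniform along mollifications of `u`. Passing to the limit gives `‖u y - b‖ ≤ M √‖y - x₀‖` for
almost every `y` near `x₀` (`exists_ae_norm_sub_le`), from which all three claims follow. -/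

/-! ### Integration along rays. -/

/-- Restricted to rays from `x`, the symmetric part of the derivative controls `v`. -/
theorem ofReal_abs_inner_sub_le {E : Type*} [NormedAddCommGroup E] [InnerProductSpace ℝ E]
    {v : E → E} {g : E → ℝ} (hv : ContDiff ℝ 1 v) (hg : Continuous g) (g0 : ∀ x, 0 ≤ g x)
    {x h : E} (hvg : ∀ t ∈ Ioc (0 : ℝ) 1,
      |inner ℝ (fderiv ℝ v (x + t • h) h) h| ≤ ‖h‖ ^ 2 * g (x + t • h)) :
    ENNReal.ofReal |inner ℝ (v (x + h) - v x) h| ≤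
      ∫⁻ t in Ioc (0 : ℝ) 1, ENNReal.ofReal (‖h‖ ^ 2 * g (x + t • h)) := by
  have hd : ∀ t : ℝ, HasDerivAt (fun t : ℝ => inner ℝ (v (x + t • h)) h)
      (inner ℝ (fderiv ℝ v (x + t • h) h) h) t := by
    intro t
    have h1 : HasDerivAt (fun t : ℝ => x + t • h) h t := by
      simpa using ((hasDerivAt_id t).smul_const h).const_add x
    have h2 := ((hv.differentiable one_ne_zero).differentiableAt
      (x := x + t • h)).hasFDerivAt.comp_hasDerivAt t h1
    simpa using h2.inner ℝ (hasDerivAt_const t h)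
  have hc : Continuous fun t : ℝ => inner ℝ (fderiv ℝ v (x + t • h) h) h := by
    have := hv.continuous_fderiv one_ne_zero
    fun_prop
  have hc' : Continuous fun t : ℝ => ‖h‖ ^ 2 * g (x + t • h) := by fun_prop
  have e1 := intervalIntegral.integral_eq_sub_of_hasDerivAt (a := 0) (b := 1)
    (fun t _ => hd t) (hc.intervalIntegrable _ _)
  have e2 := intervalIntegral.norm_integral_le_of_norm_le (μ := volume) zero_le_one
    (Eventually.of_forall fun t ht => by rw [Real.norm_eq_abs]; exact hvg t ht)
    (hc'.intervalIntegrable 0 1)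
  rw [e1, intervalIntegral.integral_of_le zero_le_one] at e2
  rw [← ofReal_integral_eq_lintegral_ofReal
    ((intervalIntegrable_iff_integrableOn_Ioc_of_le zero_le_one).1 (hc'.intervalIntegrable 0 1))
    (Eventually.of_forall fun t => mul_nonneg (sq_nonneg _) (g0 _))]
  refine ENNReal.ofReal_le_ofReal ?_
  simpa [inner_sub_left] using e2

theorem setLIntegral_ball_comp_add_smul {N : ℕ} {F : EuclideanSpace ℝ (Fin N) → ℝ≥0∞}
    (hF : Measurable F) (x : EuclideanSpace ℝ (Fin N)) {t : ℝ} (ht : 0 < t) (r : ℝ) :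
    ∫⁻ h in Metric.ball (0 : EuclideanSpace ℝ (Fin N)) r, F (x + t • h) =
      ENNReal.ofReal ((t ^ N)⁻¹) * ∫⁻ z in Metric.ball x (t * r), F z := by
  have hm : Measurable ((Metric.ball x (t * r)).indicator F) :=
    hF.indicator Metric.isOpen_ball.measurableSet
  have e := lintegral_map (μ := (volume : Measure (EuclideanSpace ℝ (Fin N))))
    (hm.comp (measurable_const_add x)) (measurable_const_smul t)
  rw [Measure.map_addHaar_smul _ ht.ne', lintegral_smul_measure] at e
  rw [← lintegral_indicator Metric.isOpen_ball.measurableSet,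
    ← lintegral_indicator Metric.isOpen_ball.measurableSet]
  have e3 : ∫⁻ a, ((Metric.ball x (t * r)).indicator F ∘ fun a => x + a) a =
      ∫⁻ z, (Metric.ball x (t * r)).indicator F z :=
    lintegral_add_left_eq_self (fun z => (Metric.ball x (t * r)).indicator F z) x
  rw [e3, finrank_euclideanSpace_fin, abs_of_pos (by positivity), smul_eq_mul] at e
  rw [e]
  refine lintegral_congr fun h => ?_
  have : x + t • h ∈ Metric.ball x (t * r) ↔ h ∈ Metric.ball 0 r := by
    simp [norm_smul, abs_of_pos ht, ht]
  by_cases hh : h ∈ Metric.ball 0 r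
  · simp only [Function.comp, indicator_of_mem hh, indicator_of_mem (this.2 hh)]
  · simp only [Function.comp, indicator_of_notMem hh, indicator_of_notMem (mt this.1 hh)]

theorem lintegral_Ioc_inv_sqrt :
    ∫⁻ t in Ioc (0 : ℝ) 1, ENNReal.ofReal ((Real.sqrt t)⁻¹) = 2 := by
  have hi : IntervalIntegrable (fun t : ℝ => t ^ (-(1 / 2) : ℝ)) volume 0 1 :=
    intervalIntegral.intervalIntegrable_rpow' (by norm_num)
  have e : ∫ t in (0 : ℝ)..1, t ^ (-(1 / 2) : ℝ) = 2 := by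
    rw [integral_rpow (Or.inl (by norm_num))]; norm_num
  rw [intervalIntegral.integral_of_le zero_le_one] at e
  have e2 := ofReal_integral_eq_lintegral_ofReal
    ((intervalIntegrable_iff_integrableOn_Ioc_of_le zero_le_one).1 hi)
    (ae_restrict_of_forall_mem measurableSet_Ioc fun t ht => Real.rpow_nonneg ht.1.le _)
  rw [e] at e2
  have : (2 : ℝ≥0∞) = ENNReal.ofReal 2 := by norm_num
  rw [this, e2]
  refine setLIntegral_congr_fun measurableSet_Ioc fun t ht => ?_
  simp only [Real.sqrt_eq_rpow]
  rw [Real.rpow_neg ht.1.le]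

/-- The growth hypothesis on `g`: `∫_{B(x,r)} g ≤ K r^{n+1/2}`, in dimension `n + 1`. -/
def HasGrowthOn {n : ℕ} (g : EuclideanSpace ℝ (Fin (n + 1)) → ℝ) (K : ℝ)
    (U : Set (EuclideanSpace ℝ (Fin (n + 1)))) : Prop :=
  ∀ x r, 0 < r → Metric.ball x r ⊆ U →
    ∫⁻ z in Metric.ball x r, ENNReal.ofReal (g z) ≤ ENNReal.ofReal (K * (r ^ n * √r))

/-- By Tonelli, the slice at parameter `t` is an integral of `g` over `B(x, t r)` with Jacobian
`t^(-(n+1))`. The growth `(t r)^(n+1/2)` leaves the weight `t^(-1/2)`, which is integrable at `0`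
with integral `2`. -/
theorem lintegral_abs_inner_sub_le {n : ℕ}
    {v : EuclideanSpace ℝ (Fin (n + 1)) → EuclideanSpace ℝ (Fin (n + 1))}
    {g : EuclideanSpace ℝ (Fin (n + 1)) → ℝ} {K : ℝ} (hK : 0 ≤ K)
    {U : Set (EuclideanSpace ℝ (Fin (n + 1)))}
    (hv : ContDiff ℝ 1 v) (hg : Continuous g) (g0 : ∀ x, 0 ≤ g x)
    (hvg : ∀ x ∈ U, ∀ h, |inner ℝ (fderiv ℝ v x h) h| ≤ ‖h‖ ^ 2 * g x)
    (hgr : HasGrowthOn g K U)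
    {x : EuclideanSpace ℝ (Fin (n + 1))} {r : ℝ} (hr : 0 < r) (hU : Metric.ball x r ⊆ U) :
    ∫⁻ z in Metric.ball x r, ENNReal.ofReal |inner ℝ (v z - v x) (z - x)| ≤
      ENNReal.ofReal (2 * K * (r ^ (n + 2) * √r)) := by
  have hmv : Continuous v := hv.continuous
  have hgm : Measurable fun z => ENNReal.ofReal (g z) := hg.measurable.ennreal_ofReal
  have step1 : ∫⁻ z in Metric.ball x r, ENNReal.ofReal |inner ℝ (v z - v x) (z - x)| =
      ∫⁻ h in Metric.ball (0 : EuclideanSpace ℝ (Fin (n + 1))) r,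
        ENNReal.ofReal |inner ℝ (v (x + h) - v x) h| := by
    have := setLIntegral_ball_comp_add_smul
      (F := fun z => ENNReal.ofReal |inner ℝ (v z - v x) (z - x)|)
      (by fun_prop) x one_pos r
    simpa using this.symm
  rw [step1]
  calc ∫⁻ h in Metric.ball (0 : EuclideanSpace ℝ (Fin (n + 1))) r,
        ENNReal.ofReal |inner ℝ (v (x + h) - v x) h|
      ≤ ∫⁻ h in Metric.ball (0 : EuclideanSpace ℝ (Fin (n + 1))) r,
          ∫⁻ t in Ioc (0 : ℝ) 1, ENNReal.ofReal (r ^ 2) * ENNReal.ofReal (g (x + t • h)) := by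
        refine setLIntegral_mono' Metric.isOpen_ball.measurableSet fun h hh => ?_
        have hh' : ‖h‖ < r := by simpa using hh
        refine (ofReal_abs_inner_sub_le hv hg g0 fun t ht => hvg _ (hU ?_) h).trans ?_
        · rw [mem_ball_iff_norm, add_sub_cancel_left, norm_smul, Real.norm_eq_abs, abs_of_pos ht.1]
          nlinarith [ht.2, norm_nonneg h]
        · refine lintegral_mono fun t => ?_
          rw [← ENNReal.ofReal_mul (sq_nonneg r)]
          exact ENNReal.ofReal_le_ofReal (mul_le_mul_of_nonneg_right
            (pow_le_pow_left₀ (norm_nonneg _) hh'.le 2) (g0 _))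
    _ = ∫⁻ t in Ioc (0 : ℝ) 1, ∫⁻ h in Metric.ball (0 : EuclideanSpace ℝ (Fin (n + 1))) r,
          ENNReal.ofReal (r ^ 2) * ENNReal.ofReal (g (x + t • h)) := by
        refine lintegral_lintegral_swap ?_
        refine Measurable.aemeasurable ?_
        refine Measurable.const_mul ?_ _
        exact hgm.comp (Continuous.measurable (by fun_prop))
    _ ≤ ∫⁻ t in Ioc (0 : ℝ) 1,
          ENNReal.ofReal (K * (r ^ (n + 2) * √r)) * ENNReal.ofReal ((√t)⁻¹) := by
        refine setLIntegral_mono' measurableSet_Ioc fun t ht => ?_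
        rw [lintegral_const_mul' _ _ ENNReal.ofReal_ne_top,
          setLIntegral_ball_comp_add_smul hgm x ht.1 r]
        have hb : Metric.ball x (t * r) ⊆ Metric.ball x r :=
          Metric.ball_subset_ball (by nlinarith [ht.2])
        refine (mul_le_mul_right (mul_le_mul_right
          (hgr x (t * r) (mul_pos ht.1 hr) (hb.trans hU)) _) _).trans ?_
        have ht0 := ht.1
        rw [← ENNReal.ofReal_mul (by positivity), ← ENNReal.ofReal_mul (by positivity),
          ← ENNReal.ofReal_mul (by positivity)]
        refine ENNReal.ofReal_le_ofReal (le_of_eq ?_)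
        rw [Real.sqrt_mul ht0.le, mul_pow]
        have hs : 0 < √t := Real.sqrt_pos.2 ht0
        have : √t * √t = t := Real.mul_self_sqrt ht0.le
        field_simp
        rw [show t ^ (n + 1) = t ^ n * (√t * √t) by rw [this]; ring]
        ring
    _ = ENNReal.ofReal (2 * K * (r ^ (n + 2) * √r)) := by
        rw [lintegral_const_mul' _ _ ENNReal.ofReal_ne_top, lintegral_Ioc_inv_sqrt,
          show (2 : ℝ≥0∞) = ENNReal.ofReal 2 by norm_num, ← ENNReal.ofReal_mul (by positivity)]
        congr 1; ring

/-! ### Pointwise bounds for smooth fields. -/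

/-- A point of `B(x,r)` lying well on the side of `δ`, where `f` is at most its average up to a
factor depending only on the dimension. -/
theorem exists_mem_ball_inner_ge {n : ℕ} :
    ∃ c : ℝ, 0 < c ∧ ∀ (f : EuclideanSpace ℝ (Fin (n + 1)) → ℝ)
      (x δ : EuclideanSpace ℝ (Fin (n + 1))) (r M : ℝ), Continuous f → 0 < r → 0 ≤ M →
      ∫⁻ z in Metric.ball x r, ENNReal.ofReal (f z) ≤ ENNReal.ofReal (M * r ^ (n + 1)) →
      ∃ z, r / 4 * ‖δ‖ ≤ inner ℝ δ (z - x) ∧ ‖z - x‖ < r ∧ f z ≤ c * M := by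
  set κ : ℝ := volume.real (Metric.ball (0 : EuclideanSpace ℝ (Fin (n + 1))) 1) with hκ
  have hκ0 : 0 < κ := ENNReal.toReal_pos (Metric.measure_ball_pos _ _ one_pos).ne'
    measure_ball_lt_top.ne
  -- The constant is `r^(n+1)` over the volume of a ball of radius `r/4`. That ball is centred at
  -- distance `r/2` from `x` in the direction of `δ`, so the inner product is at least `(r/2 - r/4)
  -- ‖δ‖` on it.
  refine ⟨4 ^ (n + 1) / κ, by positivity, fun f x δ r M hfc hr hM hf => ?_⟩
  obtain ⟨y, hy1, hy2⟩ : ∃ y : EuclideanSpace ℝ (Fin (n + 1)),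
      r / 2 * ‖δ‖ ≤ inner ℝ δ y ∧ ‖y‖ ≤ r / 2 := by
    rcases eq_or_ne δ 0 with rfl | hδ
    · exact ⟨0, by simp, by simp; positivity⟩
    · have : 0 < ‖δ‖ := norm_pos_iff.2 hδ
      refine ⟨(r / 2 / ‖δ‖) • δ, le_of_eq ?_, le_of_eq ?_⟩
      · rw [inner_smul_right, real_inner_self_eq_norm_sq]; field_simp
      · rw [norm_smul, Real.norm_eq_abs, abs_of_pos (by positivity)]; field_simp
  have hsub : Metric.ball (x + y) (r / 4) ⊆ Metric.ball x r := by
    refine Metric.ball_subset_ball' ?_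
    rw [dist_eq_norm, add_sub_cancel_left]; linarith
  have hle := (lintegral_mono_set (μ := volume) (f := fun z => ENNReal.ofReal (f z)) hsub).trans hf
  obtain ⟨z, hz, hzf⟩ := exists_le_setLAverage
    (μ := volume) (s := Metric.ball (x + y) (r / 4)) (f := fun z => ENNReal.ofReal (f z))
    (Metric.measure_ball_pos _ _ (by positivity)).ne' measure_ball_lt_top.ne
    hfc.measurable.ennreal_ofReal.aemeasurable
  have hz' : ‖z - (x + y)‖ < r / 4 := by rwa [mem_ball_iff_norm] at hz
  refine ⟨z, ?_, ?_, ?_⟩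
  · have h1 : inner ℝ δ (z - x) = inner ℝ δ y + inner ℝ δ (z - (x + y)) := by
      rw [← inner_add_right]; congr 1; abel
    have h2 := abs_le.1 (abs_real_inner_le_norm δ (z - (x + y)))
    nlinarith [norm_nonneg δ, h2.1]
  · have : z - x = (z - (x + y)) + y := by abel
    rw [this]; linarith [norm_add_le (z - (x + y)) y]
  · rw [setLAverage_eq] at hzf
    have hvol : volume (Metric.ball (x + y) (r / 4)) = ENNReal.ofReal ((r / 4) ^ (n + 1) * κ) := by
      rw [Measure.addHaar_ball _ _ (by positivity), finrank_euclideanSpace_fin,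
        ENNReal.ofReal_mul (by positivity), hκ, Measure.real,
        ENNReal.ofReal_toReal measure_ball_lt_top.ne]
    have h3 := hzf.trans (ENNReal.div_le_div_right hle _)
    rw [hvol, ← ENNReal.ofReal_div_of_pos (by positivity)] at h3
    refine ((ENNReal.ofReal_le_ofReal_iff (by positivity)).1 h3).trans (le_of_eq ?_)
    rw [div_pow]; field_simp

/-- Since `⟨v x, z - x⟩ = ⟨v z, z - x⟩ - ⟨v z - v x, z - x⟩`, it suffices to find `z` on the side of
`v x` where both terms on the right are small. Averaging the sum of their bounds controls them at
one point. -/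
theorem exists_sup_bound {n : ℕ} {R K L : ℝ} (hR : 0 < R) (hK : 0 ≤ K) (hL : 0 ≤ L) :
    ∃ M : ℝ, 0 ≤ M ∧ ∀ (v : EuclideanSpace ℝ (Fin (n + 1)) → EuclideanSpace ℝ (Fin (n + 1)))
      (g : EuclideanSpace ℝ (Fin (n + 1)) → ℝ) (U : Set (EuclideanSpace ℝ (Fin (n + 1)))),
      ContDiff ℝ 1 v → Continuous g → (∀ x, 0 ≤ g x) →
      (∀ x ∈ U, ∀ h, |inner ℝ (fderiv ℝ v x h) h| ≤ ‖h‖ ^ 2 * g x) →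
      HasGrowthOn g K U → ∫⁻ x, ‖v x‖ₑ ≤ ENNReal.ofReal L →
      ∀ x, Metric.ball x R ⊆ U → ‖v x‖ ≤ M := by
  obtain ⟨c, hc, H⟩ := exists_mem_ball_inner_ge (n := n)
  set M : ℝ := (R * L + 2 * K * (R ^ (n + 2) * √R)) / R ^ (n + 1) with hM
  have hM0 : 0 ≤ M := by positivity
  refine ⟨4 * (c * M) / R, by positivity, fun v g U hv hg g0 hvg hgr hvL x hx => ?_⟩
  have hvc : Continuous v := hv.continuous
  obtain ⟨z, hz1, hz2, hz3⟩ := H (fun z => R * ‖v z‖ + |inner ℝ (v z - v x) (z - x)|) x (v x) R M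
    (by fun_prop) hR hM0 (by
      have e : M * R ^ (n + 1) = R * L + 2 * K * (R ^ (n + 2) * √R) := by
        rw [hM]; field_simp
      rw [e, ENNReal.ofReal_add (by positivity) (by positivity)]
      simp_rw [fun z => ENNReal.ofReal_add (p := R * ‖v z‖) (q := |inner ℝ (v z - v x) (z - x)|)
        (by positivity) (abs_nonneg _)]
      rw [lintegral_add_left (by fun_prop)]
      refine add_le_add ?_ (lintegral_abs_inner_sub_le hK hv hg g0 hvg hgr hR hx)
      simp_rw [ENNReal.ofReal_mul hR.le, ofReal_norm]
      rw [lintegral_const_mul' _ _ ENNReal.ofReal_ne_top]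
      gcongr
      exact (setLIntegral_le_lintegral _ _).trans hvL)
  have h1 : inner ℝ (v x) (z - x) = inner ℝ (v z) (z - x) - inner ℝ (v z - v x) (z - x) := by
    rw [← inner_sub_left, sub_sub_cancel]
  have h2 := abs_le.1 (abs_real_inner_le_norm (v z) (z - x))
  have h3 := neg_abs_le (inner ℝ (v z - v x) (z - x))
  have h4 : ‖v z‖ * ‖z - x‖ ≤ R * ‖v z‖ := by
    rw [mul_comm]; exact mul_le_mul_of_nonneg_right hz2.le (norm_nonneg _)
  rw [le_div_iff₀ hR]
  linarith [h2.2]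

/-- Radial increments from three collinear centres to one endpoint combine so that only the second
difference and a constant survive; comparing two opposite endpoints removes the constant. -/
theorem exists_second_difference_bound {n : ℕ} {K : ℝ} (hK : 0 ≤ K) :
    ∃ M : ℝ, 0 ≤ M ∧ ∀ (v : EuclideanSpace ℝ (Fin (n + 1)) → EuclideanSpace ℝ (Fin (n + 1)))
      (g : EuclideanSpace ℝ (Fin (n + 1)) → ℝ) (U : Set (EuclideanSpace ℝ (Fin (n + 1)))),
      ContDiff ℝ 1 v → Continuous g → (∀ x, 0 ≤ g x) →
      (∀ x ∈ U, ∀ h, |inner ℝ (fderiv ℝ v x h) h| ≤ ‖h‖ ^ 2 * g x) →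
      HasGrowthOn g K U →
      ∀ x h, Metric.ball x (4 * ‖h‖) ⊆ U →
        ‖v (x + (2 : ℝ) • h) - (2 : ℝ) • v (x + h) + v x‖ ≤ M * √‖h‖ := by
  obtain ⟨c, hc, H⟩ := exists_mem_ball_inner_ge (n := n)
  -- Here `8 = (1 + 2 + 1) * 2`: the weights of the three centres times the radial constant, and `2
  -- ^ (n + 2) * √2` comes from radius `2r`. The factor `4` inverts the `r/4` of the endpoint
  -- selection.
  refine ⟨4 * c * (8 * K * 2 ^ (n + 2) * √2), by positivity, ?_⟩
  intro v g U hv hg g0 hvg hgr x h hU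
  rcases eq_or_ne h 0 with rfl | hh
  · simp [two_smul]
  set r := ‖h‖ with hr
  have hr0 : 0 < r := norm_pos_iff.2 hh
  have hvc : Continuous v := hv.continuous
  set D : EuclideanSpace ℝ (Fin (n + 1)) → EuclideanSpace ℝ (Fin (n + 1)) → ℝ :=
    fun p z => inner ℝ (v z - v p) (z - p) with hD
  have hDc : ∀ p, Continuous (D p) := fun p => by fun_prop
  have h2r : ‖(2 : ℝ) • h‖ = 2 * r := by rw [norm_smul]; simp [hr]
  -- Each centre `p` sees the common ball through `B(x+h, r) ⊆ B(p, 2r) ⊆ B(x, 4r)`.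
  have hI : ∀ p, dist (x + h) p ≤ r → dist p x ≤ 2 * r →
      ∫⁻ z in Metric.ball (x + h) r, ENNReal.ofReal |D p z| ≤
        ENNReal.ofReal (2 * K * ((2 * r) ^ (n + 2) * √(2 * r))) := by
    intro p h1 h2
    refine (lintegral_mono_set (Metric.ball_subset_ball' (ε₂ := 2 * r) (by linarith))).trans ?_
    exact lintegral_abs_inner_sub_le hK hv hg g0 hvg hgr (by positivity)
      ((Metric.ball_subset_ball' (by linarith)).trans hU)
  have hI0 := hI x (by simp [hr]) (by simp [hr0.le])
  have hI1 := hI (x + h) (by simp [hr0.le]) (by simp [← hr]; linarith)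
  have hI2 := hI (x + (2 : ℝ) • h) (by rw [dist_eq_norm, two_smul]; simp [hr])
    (by rw [dist_eq_norm, add_sub_cancel_left, h2r])
  set f : EuclideanSpace ℝ (Fin (n + 1)) → ℝ :=
    fun z => |D x z| + 2 * |D (x + h) z| + |D (x + (2 : ℝ) • h) z| with hf
  have hfc : Continuous f := by fun_prop
  have hfI : ∫⁻ z in Metric.ball (x + h) r, ENNReal.ofReal (f z) ≤
      ENNReal.ofReal ((8 * K * 2 ^ (n + 2) * √2 * (r * √r)) * r ^ (n + 1)) := by
    have e : ∀ z, ENNReal.ofReal (f z) = ENNReal.ofReal |D x z| +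
        ENNReal.ofReal 2 * ENNReal.ofReal |D (x + h) z| +
        ENNReal.ofReal |D (x + (2 : ℝ) • h) z| := by
      intro z
      rw [← ENNReal.ofReal_mul zero_le_two, ← ENNReal.ofReal_add (by positivity) (by positivity),
        ← ENNReal.ofReal_add (by positivity) (by positivity)]
    simp_rw [e]
    have hm : ∀ p, Measurable fun z => ENNReal.ofReal |D p z| :=
      fun p => (hDc p).abs.measurable.ennreal_ofReal
    rw [lintegral_add_right _ (hm _), lintegral_add_left (hm _),
      lintegral_const_mul' _ _ ENNReal.ofReal_ne_top]
    refine (add_le_add (add_le_add hI0 (mul_le_mul_right hI1 _)) hI2).trans ?_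
    rw [← ENNReal.ofReal_mul zero_le_two, ← ENNReal.ofReal_add (by positivity) (by positivity),
        ← ENNReal.ofReal_add (by positivity) (by positivity)]
    refine ENNReal.ofReal_le_ofReal (le_of_eq ?_)
    rw [Real.sqrt_mul zero_le_two, mul_pow]; ring
  set δ := v (x + (2 : ℝ) • h) - (2 : ℝ) • v (x + h) + v x with hδ
  set s : ℝ := inner ℝ (v x) h - inner ℝ (v (x + (2 : ℝ) • h)) h with hs
  -- With `w = z - (x + h)`, the vectors paired with `v z` add up to `(w + h) - 2w + (w - h) = 0`.
  -- The remainder `s` does not depend on `z`.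
  have key : ∀ z, inner ℝ δ (z - (x + h)) =
      -s - (D x z - 2 * D (x + h) z + D (x + (2 : ℝ) • h) z) := by
    intro z
    obtain ⟨w, rfl⟩ : ∃ w, z = x + h + w := ⟨z - (x + h), by abel⟩
    have e0 : x + h + w - x = h + w := by abel
    have e1 : x + h + w - (x + h) = w := by abel
    have e2 : x + h + w - (x + (2 : ℝ) • h) = w - h := by rw [two_smul]; abel
    simp only [hD, e0, e1, e2]
    simp only [hδ, hs, inner_add_right, inner_sub_right, inner_sub_left,
      inner_add_left, real_inner_smul_left]
    ring
  -- Endpoints on the sides of `δ` and `-δ`: `s` cancels when the two inequalities are added.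
  obtain ⟨z, hz1, -, hz3⟩ := H f (x + h) δ r _ hfc hr0 (by positivity) hfI
  obtain ⟨y, hy1, -, hy3⟩ := H f (x + h) (-δ) r _ hfc hr0 (by positivity) hfI
  have hab : ∀ z, |D x z - 2 * D (x + h) z + D (x + (2 : ℝ) • h) z| ≤ f z := by
    intro z
    refine (abs_add_le _ _).trans (add_le_add ((abs_sub _ _).trans (le_of_eq ?_)) le_rfl)
    rw [abs_mul, abs_two]
  rw [key] at hz1
  rw [inner_neg_left, key, norm_neg] at hy1
  have a1 := (abs_le.1 (hab z)).1
  have a2 := (abs_le.1 (hab y)).2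
  refine le_of_mul_le_mul_left ?_ hr0
  linarith

/-- Twice the increment over `h` is the increment over `2h` minus a second difference, so the
estimate descends from scale `R` to all smaller scales. -/
theorem exists_holder_bound {n : ℕ} {R K L : ℝ} (hR : 0 < R) (hK : 0 ≤ K) (hL : 0 ≤ L) :
    ∃ M : ℝ, 0 ≤ M ∧ ∀ (v : EuclideanSpace ℝ (Fin (n + 1)) → EuclideanSpace ℝ (Fin (n + 1)))
      (g : EuclideanSpace ℝ (Fin (n + 1)) → ℝ) (x : EuclideanSpace ℝ (Fin (n + 1))),
      ContDiff ℝ 1 v → Continuous g → (∀ x, 0 ≤ g x) →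
      (∀ y ∈ Metric.ball x (4 * R), ∀ h, |inner ℝ (fderiv ℝ v y h) h| ≤ ‖h‖ ^ 2 * g y) →
      HasGrowthOn g K (Metric.ball x (4 * R)) → ∫⁻ y, ‖v y‖ₑ ≤ ENNReal.ofReal L →
      ‖v x‖ ≤ M ∧ ∀ h, ‖h‖ ≤ 2 * R → ‖v (x + h) - v x‖ ≤ M * √‖h‖ := by
  obtain ⟨M₁, hM₁, H₁⟩ := exists_sup_bound (n := n) hR hK hL
  obtain ⟨M₂, hM₂, H₂⟩ := exists_second_difference_bound (n := n) hK
  have hsR : 0 < √R := Real.sqrt_pos.2 hR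
  -- The summands serve the value at `x`, the increments with `‖h‖ > R`, and the doubling step.
  set M := M₁ + 2 * M₁ / √R + 2 * M₂ with hM
  have hM0 : 0 ≤ M := by positivity
  refine ⟨M, hM0, fun v g x hv hg g0 hvg hgr hvL => ?_⟩
  have hsup : ∀ h, ‖h‖ ≤ 2 * R → ‖v (x + h)‖ ≤ M₁ := fun h hh =>
    H₁ v g _ hv hg g0 hvg hgr hvL _ (Metric.ball_subset_ball' (by
      rw [dist_eq_norm, add_sub_cancel_left]; linarith))
  have hx : ‖v x‖ ≤ M₁ := by simpa using hsup 0 (by simp [hR.le])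
  refine ⟨hx.trans ?_, ?_⟩
  · have : 0 ≤ 2 * M₁ / √R := by positivity
    linarith
  -- Here `k` bounds the number of doublings needed to bring `‖h‖` above `R`; doubling only while
  -- `‖h‖ ≤ R` keeps all points within `2R`.
  have claim : ∀ k : ℕ, ∀ h, ‖h‖ ≤ 2 * R → R < 2 ^ k * ‖h‖ →
      ‖v (x + h) - v x‖ ≤ M * √‖h‖ := by
    intro k
    have base : ∀ h, ‖h‖ ≤ 2 * R → R < ‖h‖ → ‖v (x + h) - v x‖ ≤ M * √‖h‖ := by
      intro h h1 h2
      have h3 : √R ≤ √‖h‖ := Real.sqrt_le_sqrt h2.le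
      calc ‖v (x + h) - v x‖ ≤ M₁ + M₁ := (norm_sub_le _ _).trans (add_le_add (hsup h h1) hx)
        _ = 2 * M₁ / √R * √R := by field_simp; ring
        _ ≤ M * √‖h‖ := by gcongr; rw [hM]; linarith
    induction k with
    | zero => intro h h1 h2; exact base h h1 (by simpa using h2)
    | succ k ih =>
      intro h h1 h2
      rcases lt_or_ge R ‖h‖ with h3 | h3
      · exact base h h1 h3
      have h2r : ‖(2 : ℝ) • h‖ = 2 * ‖h‖ := by rw [norm_smul]; simp
      have i1 := ih ((2 : ℝ) • h) (by rw [h2r]; linarith) (by rw [h2r]; rw [pow_succ] at h2; linarith)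
      have i2 := H₂ v g _ hv hg g0 hvg hgr x h (Metric.ball_subset_ball (by linarith))
      rw [h2r, Real.sqrt_mul zero_le_two] at i1
      have e : (2 : ℝ) • (v (x + h) - v x) = (v (x + (2 : ℝ) • h) - v x) -
          (v (x + (2 : ℝ) • h) - (2 : ℝ) • v (x + h) + v x) := by
        rw [smul_sub, two_smul, two_smul ℝ (v x)]; abel
      have e2 : 2 * ‖v (x + h) - v x‖ ≤ M * (√2 * √‖h‖) + M₂ * √‖h‖ := by
        have := congrArg norm e
        rw [norm_smul, Real.norm_two] at this
        rw [this]
        exact (norm_sub_le _ _).trans (add_le_add i1 i2)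
      -- The induction closes because `M * (3/2) + M / 2 = 2 * M`; this needs `√2 < 2`, that is, a
      -- Hölder exponent below `1`.
      have hs2 : √2 ≤ 3 / 2 := by
        rw [Real.sqrt_le_left (by norm_num)]; norm_num
      have e3 : M₂ ≤ M / 2 := by
        have : 0 ≤ 2 * M₁ / √R := by positivity
        rw [hM]; linarith
      have e4 : M * (√2 * √‖h‖) ≤ M * (3 / 2 * √‖h‖) := by gcongr
      have e5 : M₂ * √‖h‖ ≤ M / 2 * √‖h‖ := by gcongr
      linarith
  intro h hh
  rcases eq_or_ne h 0 with rfl | h0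
  · simp
  have hp : 0 < ‖h‖ := norm_pos_iff.2 h0
  obtain ⟨k, hk⟩ := pow_unbounded_of_one_lt (R / ‖h‖) one_lt_two
  exact claim k h hh ((div_lt_iff₀ hp).1 hk)

/-! ### Mollification and the weak gradient. -/

/-- A mollification is a weighted mean, of total weight one, of translates by vectors in the support
of the kernel. Uniform integral bounds for those translates therefore pass to it with the same
constant. -/
theorem setLIntegral_enorm_convolution_le {N : ℕ} {F' : Type*} [NormedAddCommGroup F']
    [NormedSpace ℝ F'] {F : EuclideanSpace ℝ (Fin N) → F'} (hF : AEStronglyMeasurable F volume)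
    (φ : ContDiffBump (0 : EuclideanSpace ℝ (Fin N))) {S : Set (EuclideanSpace ℝ (Fin N))}
    {M : ℝ≥0∞}
    (hM : ∀ t ∈ Metric.ball (0 : EuclideanSpace ℝ (Fin N)) φ.rOut,
      ∫⁻ y in S, ‖F (y - t)‖ₑ ≤ M) :
    ∫⁻ y in S, ‖(φ.normed volume ⋆[ContinuousLinearMap.lsmul ℝ ℝ, volume] F) y‖ₑ ≤ M := by
  set η := φ.normed (volume : Measure (EuclideanSpace ℝ (Fin N))) with hη
  have hη1 : ∫⁻ t, ‖η t‖ₑ = 1 := by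
    rw [← ofReal_integral_norm_eq_lintegral_enorm (φ.integrable_normed)]
    simp_rw [Real.norm_of_nonneg (φ.nonneg_normed _)]
    rw [φ.integral_normed, ENNReal.ofReal_one]
  calc ∫⁻ y in S, ‖(η ⋆[ContinuousLinearMap.lsmul ℝ ℝ, volume] F) y‖ₑ
      ≤ ∫⁻ y in S, ∫⁻ t, ‖η t‖ₑ * ‖F (y - t)‖ₑ := by
        refine lintegral_mono fun y => ?_
        rw [convolution_def]
        refine (enorm_integral_le_lintegral_enorm _).trans (le_of_eq ?_)
        simp [enorm_smul]
    _ = ∫⁻ t, ∫⁻ y in S, ‖η t‖ₑ * ‖F (y - t)‖ₑ := by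
        refine lintegral_lintegral_swap ?_
        refine AEMeasurable.mul (f := fun p : _ × _ => ‖η p.2‖ₑ) ?_ ?_
        · exact (φ.continuous_normed.measurable.comp measurable_snd).enorm.aemeasurable
        · have h1 := (hF.comp_quasiMeasurePreserving
            (quasiMeasurePreserving_sub_of_right_invariant volume volume)).enorm
          exact h1.mono_ac (Measure.restrict_le_self.absolutelyContinuous.prod
            Measure.AbsolutelyContinuous.rfl)
    _ ≤ ∫⁻ t, ‖η t‖ₑ * M := by
        refine lintegral_mono fun t => ?_
        simp only
        rw [lintegral_const_mul' _ _ enorm_ne_top]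
        by_cases ht : t ∈ Metric.ball 0 φ.rOut
        · exact mul_le_mul_right (hM t ht) _
        · rw [← φ.support_normed_eq (μ := volume), Function.notMem_support] at ht
          simp [hη, ht]
    _ = M := by
        rw [lintegral_mul_const _ φ.continuous_normed.measurable.enorm, hη1, one_mul]

theorem setLIntegral_ball_comp_sub {N : ℕ} (F : EuclideanSpace ℝ (Fin N) → ℝ≥0∞)
    (x t : EuclideanSpace ℝ (Fin N)) (r : ℝ) :
    ∫⁻ y in Metric.ball x r, F (y - t) = ∫⁻ y in Metric.ball (x - t) r, F y := by
  rw [← lintegral_indicator Metric.isOpen_ball.measurableSet,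
    ← lintegral_indicator Metric.isOpen_ball.measurableSet,
    ← lintegral_sub_right_eq_self ((Metric.ball (x - t) r).indicator F) t]
  refine lintegral_congr fun y => ?_
  have : y - t ∈ Metric.ball (x - t) r ↔ y ∈ Metric.ball x r := by simp
  by_cases hy : y ∈ Metric.ball x r
  · rw [indicator_of_mem hy, indicator_of_mem (this.2 hy)]
  · rw [indicator_of_notMem hy, indicator_of_notMem (mt this.1 hy)]

/-- The quadratic form of a weak gradient. -/
def quadForm {N : ℕ} (A : Matrix (Fin N) (Fin N) ℝ) (h : EuclideanSpace ℝ (Fin N)) : ℝ :=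
  ∑ i, ∑ j, h i * h j * A i j

/-- The antisymmetric part drops out, and Cauchy–Schwarz over index pairs applies because `h ⊗ h`
has Frobenius norm `‖h‖²`. -/
theorem abs_quadForm_le {N : ℕ} (A : Matrix (Fin N) (Fin N) ℝ) (h : EuclideanSpace ℝ (Fin N)) :
    |quadForm A h| ≤ ‖h‖ ^ 2 * √(frobSq ((1 / 2 : ℝ) • (A + A.transpose))) := by
  set S := (1 / 2 : ℝ) • (A + A.transpose) with hS
  have e : quadForm A h = ∑ p : Fin N × Fin N, (h p.1 * h p.2) * S p.1 p.2 := by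
    have e1 : quadForm A h = ∑ i, ∑ j, h i * h j * A j i := by
      rw [quadForm, Finset.sum_comm]
      exact Finset.sum_congr rfl fun i _ => Finset.sum_congr rfl fun j _ => by ring
    have e2 : quadForm A h = (1 / 2) * (quadForm A h + quadForm A h) := by ring
    rw [e2]
    nth_rw 2 [e1]
    rw [quadForm, ← Finset.sum_add_distrib, Finset.mul_sum, Fintype.sum_prod_type]
    refine Finset.sum_congr rfl fun i _ => ?_
    rw [← Finset.sum_add_distrib, Finset.mul_sum]
    refine Finset.sum_congr rfl fun j _ => ?_
    simp [hS]; ring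
  have h1 : ∑ p : Fin N × Fin N, (h p.1 * h p.2) ^ 2 = (‖h‖ ^ 2) ^ 2 := by
    rw [EuclideanSpace.real_norm_sq_eq, sq (∑ i, _), Finset.sum_mul_sum, Fintype.sum_prod_type]
    exact Finset.sum_congr rfl fun i _ => Finset.sum_congr rfl fun j _ => by ring
  have h2 : ∑ p : Fin N × Fin N, S p.1 p.2 ^ 2 = frobSq S := by
    rw [frobSq, Fintype.sum_prod_type]
  have cs := Finset.sum_mul_sq_le_sq_mul_sq Finset.univ
    (fun p : Fin N × Fin N => h p.1 * h p.2) fun p => S p.1 p.2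
  rw [← e, h1, h2] at cs
  have h3 := Real.abs_le_sqrt cs
  rwa [Real.sqrt_mul (by positivity), Real.sqrt_sq (by positivity)] at h3

/-- Testing a weak gradient twice against the direction `h`. -/
theorem IsWeakGrad.integral_inner_eq {N : ℕ} {Ω : Set (EuclideanSpace ℝ (Fin N))}
    {u : EuclideanSpace ℝ (Fin N) → EuclideanSpace ℝ (Fin N)}
    {G : EuclideanSpace ℝ (Fin N) → Matrix (Fin N) (Fin N) ℝ} (hG : IsWeakGrad Ω u G)
    {φ : EuclideanSpace ℝ (Fin N) → ℝ} (hφ : ContDiff ℝ ∞ φ) (hc : HasCompactSupport φ)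
    (hs : tsupport φ ⊆ Ω) (h : EuclideanSpace ℝ (Fin N)) :
    ∫ x in Ω, fderiv ℝ φ x h * inner ℝ (u x) h = -∫ x in Ω, φ x * quadForm (G x) h := by
  have hint : ∀ (f ψ : EuclideanSpace ℝ (Fin N) → ℝ), LocallyIntegrableOn f Ω volume →
      Continuous ψ → Function.support ψ ⊆ tsupport φ →
      IntegrableOn (fun x => f x * ψ x) Ω volume := by
    intro f ψ hf hψ hsub
    have h1 : IntegrableOn f (tsupport φ) volume := hf.integrableOn_compact_subset hs hc
    have h2 : IntegrableOn (fun x => f x * ψ x) (tsupport φ) volume :=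
      h1.mul_continuousOn hψ.continuousOn hc
    exact ((integrableOn_iff_integrable_of_support_subset
      ((Function.support_mul_subset_right f ψ).trans hsub)).1 h2).integrableOn
  have hui : ∀ i, LocallyIntegrableOn (fun x => u x i) Ω volume := fun i x hx => by
    obtain ⟨U, hU, hi⟩ := hG.locallyIntegrableOn x hx
    exact ⟨U, hU, (EuclideanSpace.proj (𝕜 := ℝ) i).integrable_comp hi⟩
  have hd : ∀ e, Continuous fun x => fderiv ℝ φ x e := fun e =>
    (hφ.continuous_fderiv (by simp)).clm_apply continuous_const
  have hds : ∀ e, Function.support (fun x => fderiv ℝ φ x e) ⊆ tsupport φ := fun e x hx =>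
    support_fderiv_subset ℝ (fun h0 => hx (by simp [h0]))
  have hh : h = ∑ j, h j • EuclideanSpace.single j (1 : ℝ) := by
    have := (EuclideanSpace.basisFun (Fin N) ℝ).sum_repr h
    simpa using this.symm
  have e1 : ∀ x, fderiv ℝ φ x h * inner ℝ (u x) h = ∑ i, ∑ j,
      h i * h j * (u x i * fderiv ℝ φ x (EuclideanSpace.single j 1)) := by
    intro x
    conv_lhs => rw [hh, map_sum, ← hh]
    rw [PiLp.inner_apply, mul_comm, Finset.sum_mul_sum]
    refine Finset.sum_congr rfl fun i _ => Finset.sum_congr rfl fun j _ => ?_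
    simp; ring
  have e2 : ∀ x, φ x * quadForm (G x) h = ∑ i, ∑ j, h i * h j * (G x i j * φ x) := by
    intro x
    rw [quadForm, Finset.mul_sum]
    refine Finset.sum_congr rfl fun i _ => ?_
    rw [Finset.mul_sum]
    exact Finset.sum_congr rfl fun j _ => by ring
  simp_rw [e1, e2]
  have i1 : ∀ i j, IntegrableOn (fun x =>
      h i * h j * (u x i * fderiv ℝ φ x (EuclideanSpace.single j 1))) Ω volume := fun i j =>
    (hint _ _ (hui i) (hd _) (hds _)).const_mul _
  have i2 : ∀ i j, IntegrableOn (fun x => h i * h j * (G x i j * φ x)) Ω volume := fun i j =>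
    (hint _ _ (hG.locallyIntegrableOn_grad i j) hφ.continuous (subset_tsupport _)).const_mul _
  rw [integral_finsetSum _ fun i _ => integrable_finsetSum _ fun j _ => i1 i j,
    integral_finsetSum _ fun i _ => integrable_finsetSum _ fun j _ => i2 i j,
    ← Finset.sum_neg_distrib]
  refine Finset.sum_congr rfl fun i _ => ?_
  rw [integral_finsetSum _ fun j _ => i1 i j, integral_finsetSum _ fun j _ => i2 i j,
    ← Finset.sum_neg_distrib]
  refine Finset.sum_congr rfl fun j _ => ?_
  rw [integral_const_mul, integral_const_mul, hG.integral_eq i j φ hφ hc hs, mul_neg]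

theorem fderiv_convolution_lsmul_apply {E : Type*} [NormedAddCommGroup E]
    [NormedSpace ℝ E] [FiniteDimensional ℝ E] [MeasurableSpace E] [BorelSpace E]
    {μ : Measure E} [μ.IsAddHaarMeasure]
    {F : Type*} [NormedAddCommGroup F] [NormedSpace ℝ F] [CompleteSpace F] {η : E → ℝ} {f : E → F}
    (hηc : HasCompactSupport η) (hη : ContDiff ℝ 1 η) (hf : LocallyIntegrable f μ) (x h : E) :
    Integrable (fun t => fderiv ℝ η t h • f (x - t)) μ ∧
    fderiv ℝ (η ⋆[ContinuousLinearMap.lsmul ℝ ℝ, μ] f) x h =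
      ∫ t, fderiv ℝ η t h • f (x - t) ∂μ := by
  have hder := hηc.hasFDerivAt_convolution_left
    (ContinuousLinearMap.lsmul ℝ ℝ : ℝ →L[ℝ] F →L[ℝ] F) hη hf x
  have hex : Integrable (fun t => ((ContinuousLinearMap.lsmul ℝ ℝ : ℝ →L[ℝ] F →L[ℝ] F).precompL
      E (fderiv ℝ η t)) (f (x - t))) μ :=
    (hηc.fderiv ℝ).convolutionExists_left
      ((ContinuousLinearMap.lsmul ℝ ℝ : ℝ →L[ℝ] F →L[ℝ] F).precompL E)
      (hη.continuous_fderiv (by simp)) hf x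
  refine ⟨?_, ?_⟩
  · simpa using hex.apply_continuousLinearMap h
  · rw [hder.fderiv, convolution_def, ContinuousLinearMap.integral_apply hex]
    simp

/-- The mollified field inherits, on rays, a bound by the mollified symmetrized gradient. -/
theorem IsWeakGrad.abs_inner_fderiv_convolution_le {N : ℕ} {Ω K : Set (EuclideanSpace ℝ (Fin N))}
    {u : EuclideanSpace ℝ (Fin N) → EuclideanSpace ℝ (Fin N)}
    {G : EuclideanSpace ℝ (Fin N) → Matrix (Fin N) (Fin N) ℝ}
    (hΩ : MeasurableSet Ω) (hG : IsWeakGrad Ω u G) (hKΩ : K ⊆ Ω)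
    (hu : Integrable (K.indicator u) volume)
    {q : EuclideanSpace ℝ (Fin N) → ℝ} (hq : Integrable q volume)
    (hqG : ∀ x ∈ Ω, √(frobSq ((1 / 2 : ℝ) • (G x + (G x).transpose))) ≤ q x)
    (hq0 : ∀ x, 0 ≤ q x)
    (φ : ContDiffBump (0 : EuclideanSpace ℝ (Fin N))) {x : EuclideanSpace ℝ (Fin N)}
    (hx : Metric.closedBall x φ.rOut ⊆ K) (h : EuclideanSpace ℝ (Fin N)) :
    |inner ℝ (fderiv ℝ (φ.normed volume ⋆[ContinuousLinearMap.lsmul ℝ ℝ, volume]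
        (K.indicator u)) x h) h| ≤
      ‖h‖ ^ 2 * (φ.normed volume ⋆[ContinuousLinearMap.lsmul ℝ ℝ, volume] q) x := by
  set η := φ.normed (volume : Measure (EuclideanSpace ℝ (Fin N))) with hη
  set f := K.indicator u with hf
  have hηc : HasCompactSupport η := φ.hasCompactSupport_normed
  have hηs : ContDiff ℝ ∞ η := φ.contDiff_normed
  obtain ⟨hex, hder⟩ := fderiv_convolution_lsmul_apply hηc (hηs.of_le (by simp))
    hu.locallyIntegrable x h
  -- The reflected kernel is the test function: it vanishes off `K`, so the truncation of `u` to `K`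
  -- goes unseen.
  set ψ : EuclideanSpace ℝ (Fin N) → ℝ := fun y => η (x - y) with hψ
  have hψs : ContDiff ℝ ∞ ψ := hηs.comp (contDiff_const.sub contDiff_id)
  have hψsupp : tsupport ψ ⊆ Metric.closedBall x φ.rOut := by
    refine closure_minimal (fun y hy => ?_) Metric.isClosed_closedBall
    have : x - y ∈ Function.support η := hy
    rw [hη, φ.support_normed_eq, mem_ball_zero_iff] at this
    rw [mem_closedBall_iff_norm']; exact this.le
  have hψc : HasCompactSupport ψ :=
    HasCompactSupport.of_support_subset_isCompact (isCompact_closedBall x φ.rOut)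
      ((subset_tsupport _).trans hψsupp)
  have hψd : ∀ y, fderiv ℝ ψ y h = -fderiv ℝ η (x - y) h := by
    intro y
    have h1 : HasFDerivAt (fun y => x - y)
        (-ContinuousLinearMap.id ℝ (EuclideanSpace ℝ (Fin N))) y := by
      simpa using (hasFDerivAt_id y).const_sub x
    have h2 := ((hηs.differentiable (by simp)).differentiableAt (x := x - y)).hasFDerivAt.comp y h1
    rw [show ψ = η ∘ fun y => x - y from rfl, h2.fderiv]
    simp
  have hψz : ∀ y, y ∉ K → ψ y = 0 ∧ fderiv ℝ ψ y h = 0 := by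
    intro y hy
    have hy' : y ∉ tsupport ψ := fun h' => hy (hx (hψsupp h'))
    refine ⟨image_eq_zero_of_notMem_tsupport hy', ?_⟩
    have : fderiv ℝ ψ y = 0 := by
      by_contra h0
      exact hy' (support_fderiv_subset ℝ h0)
    rw [this]; rfl
  have e1 : inner ℝ (fderiv ℝ (η ⋆[ContinuousLinearMap.lsmul ℝ ℝ, volume] f) x h) h =
      -∫ y in Ω, fderiv ℝ ψ y h * inner ℝ (u y) h := by
    rw [hder, real_inner_comm, ← integral_inner hex,
      ← integral_sub_left_eq_self _ _ x, ← integral_neg,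
      setIntegral_eq_integral_of_forall_compl_eq_zero
        (fun y hy => by rw [(hψz y fun h' => hy (hKΩ h')).2]; simp)]
    refine integral_congr_ae (Eventually.of_forall fun y => ?_)
    by_cases hy : y ∈ K
    · simp [hψd, hf, hy, inner_smul_right, real_inner_comm]
    · have := (hψz y hy).2
      simp [hf, hy, this]
  rw [e1, hG.integral_inner_eq hψs hψc (hψsupp.trans (hx.trans hKΩ)) h, neg_neg]
  have hqi : Integrable (fun t => η t • q (x - t)) volume :=
    hηc.convolutionExists_left (ContinuousLinearMap.lsmul ℝ ℝ) hηs.continuous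
      hq.locallyIntegrable x
  have hqi' : Integrable (fun y => ψ y * q y) volume := by
    have := hqi.comp_sub_left x
    simpa [hψ] using this
  have e2 : (η ⋆[ContinuousLinearMap.lsmul ℝ ℝ, volume] q) x = ∫ y, ψ y * q y := by
    rw [convolution_def, ← integral_sub_left_eq_self _ _ x]
    simp [hψ]
  have hψ0 : ∀ y, 0 ≤ ψ y := fun y => φ.nonneg_normed _
  rw [e2, ← integral_const_mul, ← Real.norm_eq_abs]
  refine (norm_integral_le_of_norm_le (hqi'.const_mul (‖h‖ ^ 2)).integrableOn
    (ae_restrict_of_forall_mem hΩ fun y hy => ?_)).trans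
    (setIntegral_le_integral (hqi'.const_mul _) (Eventually.of_forall fun y => ?_))
  · rw [norm_mul, Real.norm_eq_abs, Real.norm_eq_abs, abs_of_nonneg (hψ0 y)]
    have := mul_le_mul_of_nonneg_left ((abs_quadForm_le (G y) h).trans
      (mul_le_mul_of_nonneg_left (hqG y hy) (sq_nonneg _))) (hψ0 y)
    linarith
  · have := hψ0 y
    have := hq0 y
    simp only [Pi.zero_apply]
    positivity

/-! ### From the energy bound to almost everywhere Hölder closeness. -/

/-- Growth of the integrals of `Q` over balls gives growth of the integrals of `√Q`. -/
theorem exists_growth_of_sq_growth {n : ℕ} {Q : EuclideanSpace ℝ (Fin (n + 1)) → ℝ}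
    (hQ : ∀ x, 0 ≤ Q x) {U : Set (EuclideanSpace ℝ (Fin (n + 1)))} {C : ℝ} (hC : 0 ≤ C)
    (hE : ∀ x r, 0 < r → Metric.ball x r ⊆ U →
      ∫⁻ z in Metric.ball x r, ENNReal.ofReal (Q z) ≤ ENNReal.ofReal (C * r ^ n)) :
    ∃ K : ℝ, 0 ≤ K ∧ HasGrowthOn (fun x => √(Q x)) K U := by
  set κ : ℝ := volume.real (Metric.ball (0 : EuclideanSpace ℝ (Fin (n + 1))) 1) with hκ
  have hκ0 : 0 ≤ κ := ENNReal.toReal_nonneg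
  refine ⟨C + κ, by positivity, fun x r hr hU => ?_⟩
  have hs : 0 < √r := Real.sqrt_pos.2 hr
  have hss : √r * √r = r := Real.mul_self_sqrt hr.le
  -- Young's inequality, weighted by `√r` so that both terms integrate to order `r^(n+1/2)`.
  have hpt : ∀ z, ENNReal.ofReal (√(Q z)) ≤
      ENNReal.ofReal (√r)⁻¹ + ENNReal.ofReal √r * ENNReal.ofReal (Q z) := by
    intro z
    rw [← ENNReal.ofReal_mul hs.le, ← ENNReal.ofReal_add (by positivity)
      (mul_nonneg hs.le (hQ z))]
    refine ENNReal.ofReal_le_ofReal ?_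
    have h1 : √(Q z) * √(Q z) = Q z := Real.mul_self_sqrt (hQ z)
    have h2 := sq_nonneg (√r * √(Q z) - 1)
    have h3 := mul_nonneg hs.le (Real.sqrt_nonneg (Q z))
    refine le_of_mul_le_mul_left ?_ hs
    rw [mul_add, mul_inv_cancel₀ hs.ne', ← mul_assoc, hss]
    have h4 : (√r * √(Q z)) ^ 2 = r * Q z := by rw [mul_pow, sq, sq, hss, h1]
    nlinarith
  have hvol : volume (Metric.ball x r) = ENNReal.ofReal (r ^ (n + 1) * κ) := by
    rw [Measure.addHaar_ball _ _ hr.le, finrank_euclideanSpace_fin,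
      ENNReal.ofReal_mul (by positivity), hκ, Measure.real,
      ENNReal.ofReal_toReal measure_ball_lt_top.ne]
  refine (lintegral_mono hpt).trans ?_
  rw [lintegral_add_left measurable_const, setLIntegral_const,
    lintegral_const_mul' _ _ ENNReal.ofReal_ne_top, hvol]
  refine (add_le_add_right (mul_le_mul_right (hE x r hr hU) _) _).trans ?_
  rw [← ENNReal.ofReal_mul (by positivity), ← ENNReal.ofReal_mul (by positivity),
    ← ENNReal.ofReal_add (by positivity) (by positivity)]
  refine ENNReal.ofReal_le_ofReal (le_of_eq ?_)
  rw [show r ^ (n + 1) = r ^ n * (√r * √r) by rw [hss, pow_succ]]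
  field_simp
  ring

theorem isWeakGrad_weakGrad {N : ℕ} {Ω : Set (EuclideanSpace ℝ (Fin N))}
    {u : EuclideanSpace ℝ (Fin N) → EuclideanSpace ℝ (Fin N)} (hu : MemW12Loc Ω u) :
    IsWeakGrad Ω u (weakGrad Ω u) := by
  obtain ⟨-, G, hG, -⟩ := hu
  have h : ∃ G, IsWeakGrad Ω u G := ⟨G, hG⟩
  rw [weakGrad, dif_pos h]
  exact h.choose_spec

theorem frobSq_nonneg {N : ℕ} (A : Matrix (Fin N) (Fin N) ℝ) : 0 ≤ frobSq A :=
  Finset.sum_nonneg fun _ _ => Finset.sum_nonneg fun _ _ => sq_nonneg _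

theorem aestronglyMeasurable_sqrt_frobSq_symGrad {N : ℕ} {Ω : Set (EuclideanSpace ℝ (Fin N))}
    {u : EuclideanSpace ℝ (Fin N) → EuclideanSpace ℝ (Fin N)} (hu : MemW12Loc Ω u) :
    AEStronglyMeasurable (fun x => √(frobSq (symGrad Ω u x))) (volume.restrict Ω) := by
  have hG := isWeakGrad_weakGrad hu
  refine Real.continuous_sqrt.comp_aestronglyMeasurable ?_
  unfold frobSq
  refine Finset.aestronglyMeasurable_fun_sum _ fun i _ =>
    Finset.aestronglyMeasurable_fun_sum _ fun j _ => ?_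
  have h1 := (hG.locallyIntegrableOn_grad i j).aestronglyMeasurable
  have h2 := (hG.locallyIntegrableOn_grad j i).aestronglyMeasurable
  have : (fun x => symGrad Ω u x i j ^ 2) =
      fun x => ((1 / 2 : ℝ) * (weakGrad Ω u x i j + weakGrad Ω u x j i)) ^ 2 := by
    ext x; simp [symGrad]
  rw [this]
  exact ((h1.add h2).const_mul _).pow 2

/-- Near every point, `u` is almost everywhere `1/2`-Hölder close to a constant. -/
theorem exists_ae_norm_sub_le {n : ℕ}
    {u : EuclideanSpace ℝ (Fin (n + 1)) → EuclideanSpace ℝ (Fin (n + 1))}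
    (hu : MemW12Loc (Metric.ball 0 1) u) {C : ℝ} (hC : 0 ≤ C)
    (hE : ∀ (x₀ : EuclideanSpace ℝ (Fin (n + 1))) (r : ℝ), 0 < r →
      Metric.ball x₀ r ⊆ Metric.ball 0 1 →
      ∫⁻ x in Metric.ball x₀ r,
          ENNReal.ofReal (frobSq (symGrad (Metric.ball 0 1) u x)) ∂volume
        ≤ ENNReal.ofReal (C * r ^ n))
    {x₀ : EuclideanSpace ℝ (Fin (n + 1))} (hx₀ : x₀ ∈ Metric.ball 0 1) :
    ∃ (b : EuclideanSpace ℝ (Fin (n + 1))) (M R : ℝ), 0 ≤ M ∧ 0 < R ∧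
      ∀ᵐ y, ‖y - x₀‖ < R → ‖u y - b‖ ≤ M * √‖y - x₀‖ := by
  set Ω : Set (EuclideanSpace ℝ (Fin (n + 1))) := Metric.ball 0 1 with hΩ
  have hΩm : MeasurableSet Ω := Metric.isOpen_ball.measurableSet
  have hG := isWeakGrad_weakGrad hu
  obtain ⟨K, hK, hgr⟩ := exists_growth_of_sq_growth
    (fun x => frobSq_nonneg (symGrad Ω u x)) hC hE
  set e : EuclideanSpace ℝ (Fin (n + 1)) → ℝ := fun x => √(frobSq (symGrad Ω u x)) with he
  set q := Ω.indicator e with hq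
  have hq0 : ∀ x, 0 ≤ q x := fun x => indicator_nonneg (fun x _ => Real.sqrt_nonneg _) x
  have hqi : Integrable q volume := by
    rw [hq, integrable_indicator_iff hΩm]
    refine ⟨aestronglyMeasurable_sqrt_frobSq_symGrad hu, ?_⟩
    have := hgr 0 1 one_pos (by rfl)
    rw [HasFiniteIntegral]
    refine lt_of_le_of_lt (le_trans (le_of_eq ?_) this) ENNReal.ofReal_lt_top
    exact lintegral_congr fun x => Real.enorm_of_nonneg (Real.sqrt_nonneg _)
  have hqG : ∀ x ∈ Ω, √(frobSq ((1 / 2 : ℝ) • (weakGrad Ω u x + (weakGrad Ω u x).transpose))) ≤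
      q x := fun x hx => by rw [hq, indicator_of_mem hx]; rfl
  rw [hΩ, mem_ball_zero_iff] at hx₀
  -- Room for `8R`: the Hölder bound uses `B(x₀, 4R)`, and mollification shifts points by at most a
  -- further `4R`.
  obtain ⟨R, hR, hR8⟩ : ∃ R : ℝ, 0 < R ∧ ‖x₀‖ + 8 * R < 1 :=
    ⟨(1 - ‖x₀‖) / 16, by linarith, by linarith⟩
  set B := Metric.closedBall x₀ (8 * R) with hB
  have hBΩ : B ⊆ Ω := Metric.closedBall_subset_ball' (by rw [dist_zero_right]; linarith)
  have hBm : MeasurableSet B := Metric.isClosed_closedBall.measurableSet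
  set f := B.indicator u with hf
  have hfi : Integrable f volume := (integrable_indicator_iff hBm).2
    (hG.locallyIntegrableOn.integrableOn_compact_subset hBΩ (isCompact_closedBall _ _))
  obtain ⟨M, hM, H⟩ := exists_holder_bound (n := n) hR hK
    (integral_nonneg fun x => norm_nonneg (f x) : 0 ≤ ∫ x, ‖f x‖)
  -- The outer radii tend to `0` with fixed ratio `2` to the inner ones, as needed for almost
  -- everywhere convergence at Lebesgue points.
  let φ : ℕ → ContDiffBump (0 : EuclideanSpace ℝ (Fin (n + 1))) := fun k =>
    ⟨2 * R / (k + 1), 4 * R / (k + 1), by positivity, by gcongr; norm_num⟩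
  have hφR : ∀ k, (φ k).rOut ≤ 4 * R := fun k =>
    div_le_self (by positivity) (by linarith [Nat.cast_nonneg (α := ℝ) k])
  let v : ℕ → EuclideanSpace ℝ (Fin (n + 1)) → EuclideanSpace ℝ (Fin (n + 1)) := fun k =>
    (φ k).normed volume ⋆[ContinuousLinearMap.lsmul ℝ ℝ, volume] f
  let g : ℕ → EuclideanSpace ℝ (Fin (n + 1)) → ℝ := fun k =>
    (φ k).normed volume ⋆[ContinuousLinearMap.lsmul ℝ ℝ, volume] q
  have hvk : ∀ k, ‖v k x₀‖ ≤ M ∧ ∀ h, ‖h‖ ≤ 2 * R → ‖v k (x₀ + h) - v k x₀‖ ≤ M * √‖h‖ := by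
    intro k
    have g0 : ∀ x, 0 ≤ g k x := fun x =>
      integral_nonneg fun t => mul_nonneg ((φ k).nonneg_normed t) (hq0 _)
    refine H (v k) (g k) x₀ ?_ ?_ g0 ?_ ?_ ?_
    · exact (φ k).hasCompactSupport_normed.contDiff_convolution_left (n := 1) _
        (φ k).contDiff_normed hfi.locallyIntegrable
    · exact ((φ k).hasCompactSupport_normed.contDiff_convolution_left (n := 1) _
        (φ k).contDiff_normed hqi.locallyIntegrable).continuous
    · intro y hy h
      refine hG.abs_inner_fderiv_convolution_le hΩm hBΩ hfi hqi hqG hq0 (φ k) ?_ h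
      exact Metric.closedBall_subset_closedBall' (by linarith [hφR k, Metric.mem_ball.1 hy])
    · intro x r hr hxr
      have e1 : ∀ z, ENNReal.ofReal (g k z) = ‖g k z‖ₑ := fun z =>
        (Real.enorm_of_nonneg (g0 z)).symm
      simp_rw [e1]
      refine setLIntegral_enorm_convolution_le hqi.aestronglyMeasurable (φ k) fun t ht => ?_
      rw [setLIntegral_ball_comp_sub (fun y => ‖q y‖ₑ)]
      have hsub : Metric.ball (x - t) r ⊆ Ω := by
        intro y hy
        have h1 : y + t ∈ Metric.ball x₀ (4 * R) := hxr (by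
          rw [mem_ball_iff_norm] at hy ⊢
          convert hy using 2; abel)
        rw [mem_ball_iff_norm] at h1
        rw [mem_ball_zero_iff] at ht
        rw [hΩ, mem_ball_zero_iff]
        have h2 : y = x₀ + (y + t - x₀) - t := by abel
        have h3 := norm_sub_le (x₀ + (y + t - x₀)) t
        have h4 := norm_add_le x₀ (y + t - x₀)
        rw [← h2] at h3
        linarith [hφR k]
      refine le_trans (le_of_eq ?_) (hgr (x - t) r hr hsub)
      refine setLIntegral_congr_fun Metric.isOpen_ball.measurableSet fun y hy => ?_
      simp only [hq, indicator_of_mem (hsub hy)]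
      exact Real.enorm_of_nonneg (Real.sqrt_nonneg _)
    · rw [ofReal_integral_norm_eq_lintegral_enorm hfi, ← setLIntegral_univ]
      refine setLIntegral_enorm_convolution_le hfi.aestronglyMeasurable (φ k) fun t _ => ?_
      rw [setLIntegral_univ, lintegral_sub_right_eq_self (fun y => ‖f y‖ₑ) t]
  -- The values `v k x₀` are only known to be bounded, `x₀` not being known to be a Lebesgue point,
  -- so `b` is a subsequential limit.
  obtain ⟨b, -, σ, hσ, hb⟩ := tendsto_subseq_of_bounded
    (Metric.isBounded_closedBall (x := (0 : EuclideanSpace ℝ (Fin (n + 1)))) (r := M))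
    (x := fun k => v k x₀) (fun k => mem_closedBall_zero_iff.2 (hvk k).1)
  have hconv : ∀ᵐ y, Tendsto (fun k => v k y) atTop (𝓝 (f y)) := by
    refine ContDiffBump.ae_convolution_tendsto_right_of_locallyIntegrable (K := 2) ?_ ?_
      hfi.locallyIntegrable
    · have := (tendsto_one_div_add_atTop_nhds_zero_nat (𝕜 := ℝ)).const_mul (4 * R)
      simpa [φ, div_eq_mul_inv] using this
    · exact Eventually.of_forall fun k => le_of_eq (by simp only [φ]; ring)
  refine ⟨b, M, 2 * R, hM, by positivity, ?_⟩
  filter_upwards [hconv] with y hy hyR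
  have hyB : f y = u y := indicator_of_mem
    (show y ∈ B by rw [hB, mem_closedBall_iff_norm]; linarith) u
  rw [hyB] at hy
  refine le_of_tendsto ((hy.comp hσ.tendsto_atTop).sub hb).norm (Eventually.of_forall fun k => ?_)
  simpa using (hvk (σ k)).2 (y - x₀) hyR.le

/-! ### Limits of averages over balls and half balls. -/

theorem tendsto_ofReal_mul_sqrt_nhdsGT_zero (M : ℝ) :
    Tendsto (fun r : ℝ => ENNReal.ofReal (M * √r)) (𝓝[>] 0) (𝓝 0) := by
  have h : Continuous fun r : ℝ => ENNReal.ofReal (M * √r) :=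
    ENNReal.continuous_ofReal.comp (by fun_prop)
  simpa using (h.tendsto 0).mono_left nhdsWithin_le_nhds

/-- Points with a one-sided approximate limit `a` and an almost everywhere modulus of continuity
towards `b` have `a = b`. -/
theorem eq_of_tendsto_laverage_halfBall {N : ℕ}
    {u : EuclideanSpace ℝ (Fin N) → EuclideanSpace ℝ (Fin N)}
    {x a b ν : EuclideanSpace ℝ (Fin N)} {M R : ℝ} (hM : 0 ≤ M) (hR : 0 < R) (hν : ‖ν‖ = 1)
    (hb : ∀ᵐ y, ‖y - x‖ < R → ‖u y - b‖ ≤ M * √‖y - x‖)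
    (ha : Tendsto (fun r : ℝ => ⨍⁻ y in halfBall x r ν, ‖u y - a‖ₑ ∂volume) (𝓝[>] 0) (𝓝 0)) :
    a = b := by
  have hlim := ha.add (tendsto_ofReal_mul_sqrt_nhdsGT_zero M)
  rw [add_zero] at hlim
  suffices h : ‖b - a‖ₑ ≤ 0 by
    have : b - a = 0 := by simpa using h
    exact (sub_eq_zero.1 this).symm
  refine ge_of_tendsto hlim ?_
  filter_upwards [Ioo_mem_nhdsGT hR] with r hr
  have hopen : IsOpen (halfBall x r ν) := by
    have h : IsOpen {y : EuclideanSpace ℝ (Fin N) | 0 < inner ℝ (y - x) ν} :=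
      isOpen_lt continuous_const (by fun_prop)
    exact Metric.isOpen_ball.inter h
  have hne : (halfBall x r ν).Nonempty := by
    refine ⟨x + (r / 2) • ν, ?_, ?_⟩
    · rw [mem_ball_iff_norm, add_sub_cancel_left, norm_smul, hν, Real.norm_eq_abs,
        abs_of_pos (half_pos hr.1)]
      linarith [hr.1]
    · rw [add_sub_cancel_left, real_inner_smul_left, real_inner_self_eq_norm_sq, hν]
      have := hr.1
      positivity
  have hpos := (hopen.measure_pos volume hne).ne'
  have hfin : volume (halfBall x r ν) ≠ ⊤ :=
    ((measure_mono (fun y hy => hy.1 : halfBall x r ν ⊆ Metric.ball x r)).trans_lt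
      measure_ball_lt_top).ne
  -- Averaging the triangle inequality bounds the constant `‖b - a‖` by a quantity that tends to `0`
  -- with `r`.
  have hle : ∫⁻ _ in halfBall x r ν, ‖b - a‖ₑ ≤
      ∫⁻ y in halfBall x r ν, (‖u y - a‖ₑ + ENNReal.ofReal (M * √r)) := by
    refine lintegral_mono_ae ?_
    filter_upwards [ae_restrict_of_ae hb, ae_restrict_mem hopen.measurableSet] with y hy hyr
    have h1 : ‖y - x‖ < r := mem_ball_iff_norm.1 hyr.1
    have h2 : ‖b - a‖ₑ ≤ ‖u y - a‖ₑ + ‖u y - b‖ₑ := by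
      have : b - a = (u y - a) - (u y - b) := by abel
      rw [this]; exact enorm_sub_le
    refine h2.trans (add_le_add_right ?_ _)
    rw [← ofReal_norm]
    exact ENNReal.ofReal_le_ofReal ((hy (h1.trans hr.2)).trans
      (mul_le_mul_of_nonneg_left (Real.sqrt_le_sqrt h1.le) hM))
  rw [lintegral_add_right _ measurable_const, setLIntegral_const, setLIntegral_const] at hle
  rw [setLAverage_eq]
  calc ‖b - a‖ₑ = ‖b - a‖ₑ * volume (halfBall x r ν) / volume (halfBall x r ν) :=
        (ENNReal.mul_div_cancel_right hpos hfin).symm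
    _ ≤ _ := ENNReal.div_le_div_right hle _
    _ = _ := by rw [ENNReal.add_div, ENNReal.mul_div_cancel_right hpos hfin]

/-- Averages over shrinking balls of functions with a modulus of continuity at `x` vanish. -/
theorem tendsto_laverage_ball_of_ae_le {N : ℕ} {F : EuclideanSpace ℝ (Fin N) → ℝ≥0∞}
    {x : EuclideanSpace ℝ (Fin N)} {w : ℝ → ℝ≥0∞} {R : ℝ} (hR : 0 < R)
    (hw : Tendsto w (𝓝[>] 0) (𝓝 0))
    (hF : ∀ r ∈ Ioo 0 R, ∀ᵐ y, ‖y - x‖ < r → F y ≤ w r) :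
    Tendsto (fun r : ℝ => ⨍⁻ y in Metric.ball x r, F y ∂volume) (𝓝[>] 0) (𝓝 0) := by
  refine tendsto_of_tendsto_of_tendsto_of_le_of_le' tendsto_const_nhds hw
    (Eventually.of_forall fun _ => zero_le) ?_
  filter_upwards [Ioo_mem_nhdsGT hR] with r hr
  have hle : ∫⁻ y in Metric.ball x r, F y ≤ ∫⁻ _ in Metric.ball x r, w r := by
    refine lintegral_mono_ae ?_
    filter_upwards [ae_restrict_of_ae (hF r hr),
      ae_restrict_mem Metric.isOpen_ball.measurableSet] with y hy hyr
    exact hy (mem_ball_iff_norm.1 hyr)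
  rw [setLIntegral_const] at hle
  rw [setLAverage_eq]
  exact ENNReal.div_le_of_le_mul hle

end SymGrad

theorem propositionA1 (N : ℕ) (hN : 2 ≤ N)
    (u : EuclideanSpace ℝ (Fin N) → EuclideanSpace ℝ (Fin N))
    (hu : SymGrad.MemW12Loc (Metric.ball 0 1) u)
    (C : ℝ) (hC : 1 ≤ C)
    (hE : ∀ (x₀ : EuclideanSpace ℝ (Fin N)) (r : ℝ), 0 < r →
      Metric.ball x₀ r ⊆ Metric.ball 0 1 →
      ∫⁻ x in Metric.ball x₀ r,
          ENNReal.ofReal (SymGrad.frobSq (SymGrad.symGrad (Metric.ball 0 1) u x)) ∂volume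
        ≤ ENNReal.ofReal (C * r ^ (N - 1))) :
    (∀ x₀ ∈ Metric.ball (0 : EuclideanSpace ℝ (Fin N)) 1, ∃ b : EuclideanSpace ℝ (Fin N),
      Tendsto (fun r : ℝ => ⨍⁻ x in Metric.ball x₀ r, ‖u x - b‖ₑ ^ 2 ∂volume)
        (𝓝[>] 0) (𝓝 0)) ∧
    SymGrad.approxDiscontSet (Metric.ball 0 1) u = ∅ ∧
    SymGrad.jumpSet (Metric.ball 0 1) u = ∅ := by
  -- Writing `N = n + 1` turns the truncated exponent `N - 1` into `n`.
  obtain ⟨n, rfl⟩ : ∃ n, N = n + 1 := ⟨N - 1, by omega⟩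
  rw [Nat.add_sub_cancel] at hE
  have key : ∀ x₀ ∈ Metric.ball (0 : EuclideanSpace ℝ (Fin (n + 1))) 1, _ :=
    fun x₀ hx₀ => SymGrad.exists_ae_norm_sub_le hu (zero_le_one.trans hC) hE hx₀
  have hlim := SymGrad.tendsto_ofReal_mul_sqrt_nhdsGT_zero
  have hpt : ∀ {x b : EuclideanSpace ℝ (Fin (n + 1))} {M R : ℝ}, 0 ≤ M →
      (∀ᵐ y, ‖y - x‖ < R → ‖u y - b‖ ≤ M * √‖y - x‖) → ∀ r ∈ Ioo 0 R,
      ∀ᵐ y, ‖y - x‖ < r → ‖u y - b‖ₑ ≤ ENNReal.ofReal (M * √r) := by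
    intro x b M R hM hb r hr
    filter_upwards [hb] with y hy hyr
    rw [← ofReal_norm]
    exact ENNReal.ofReal_le_ofReal ((hy (hyr.trans hr.2)).trans
      (mul_le_mul_of_nonneg_left (Real.sqrt_le_sqrt hyr.le) hM))
  refine ⟨fun x₀ hx₀ => ?_, ?_, ?_⟩
  · obtain ⟨b, M, R, hM, hR, hb⟩ := key x₀ hx₀
    refine ⟨b, SymGrad.tendsto_laverage_ball_of_ae_le hR
      (w := fun r => ENNReal.ofReal (M * √r) ^ 2)
      (by simpa using ENNReal.Tendsto.pow (n := 2) (hlim M)) fun r hr => ?_⟩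
    filter_upwards [hpt hM hb r hr] with y hy hyr
    exact pow_le_pow_left' (hy hyr) 2
  · refine eq_empty_of_forall_notMem fun x hx => hx.2 ?_
    obtain ⟨b, M, R, hM, hR, hb⟩ := key x hx.1
    exact ⟨b, SymGrad.tendsto_laverage_ball_of_ae_le hR (hlim M) (hpt hM hb)⟩
  · refine eq_empty_of_forall_notMem fun x hx => ?_
    obtain ⟨hxΩ, a, a', ν, hne, hν, ha, ha'⟩ := hx
    obtain ⟨b, M, R, hM, hR, hb⟩ := key x hxΩ
    exact hne ((SymGrad.eq_of_tendsto_laverage_halfBall hM hR hν hb ha).trans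
      (SymGrad.eq_of_tendsto_laverage_halfBall hM hR (by rwa [norm_neg]) hb ha').symm)
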